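/- For an integer $r \ge 1$, an $r$-graph is a finite vertex set together with a set of $r$-element subsets of it, called edges. For a (possibly infinite) family $\mathcal F$ of $r$-graphs let $\mathrm{ex}(n,\mathcal F)$ be the maximum number of edges of an $r$-graph on $n$ vertices that contains no subgraph isomorphic to a member of $\mathcal F$ (and $0$ if no such $r$-graph exists), and let $\pi(\mathcal F)=\lim_{n\to\infty}\mathrm{ex}(n,\mathcal F)/\binom nr$ be its Turán density. Let $\Pi_\infty^{(r)}$ be the set of all Turán densities of families of $r$-graphs. A number $\alpha\in(0,1)$ is a jump for $r$-graphs if there is $\varepsilon>0$ with $\Pi_\infty^{(r)}\cap(\alpha,\alpha+\varepsilon)=\emptyset$; otherwise $\alpha\in(0,1)$ is a non-jump for $r$-graphs. Let $r\ge 3$ be an integer and $c>0$ a real number such that $c\,\frac{r!}{r^r}$ is a non-jump for $r$-graphs. Then for every integer $q\ge r$ the number $c\,\frac{q!}{q^q}$ is a non-jump for $q$-graphs. -/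

import Mathlib

open Filter Topology

/-- A (simple) `r`-graph with vertex set `V`: a finite set of `r`-element subsets of `V`. -/
structure RGraph (r : ℕ) (V : Type*) where
  edges : Finset (Finset V)
  sized : (edges : Set (Finset V)).Sized r

namespace RGraph

/-- `F ⊆ G` up to isomorphism: an injection of vertex sets that maps edges to edges. -/
def IsContained {r : ℕ} {V W : Type*} (F : RGraph r V) (G : RGraph r W) : Prop :=
  ∃ f : V ↪ W, ∀ e ∈ F.edges, e.map f ∈ G.edges

/-- A (possibly infinite) family of finite `r`-graphs. Every finite `r`-graph is isomorphic to one
with vertex set `Fin m`. -/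
abbrev Family (r : ℕ) : Type := Set (Σ m : ℕ, RGraph r (Fin m))

/-- `G` is `𝓕`-free: no subgraph of `G` is (isomorphic to) a member of `𝓕`. -/
def IsFree {r : ℕ} {W : Type*} (𝓕 : Family r) (G : RGraph r W) : Prop :=
  ∀ F ∈ 𝓕, ¬ F.2.IsContained G

/-- The Turán function: the maximum number of edges of an `𝓕`-free `r`-graph on `n` vertices
(`0` if there is no such `r`-graph). The set is bounded, so this supremum is its maximum whenever
it is nonempty. -/
noncomputable def ex {r : ℕ} (n : ℕ) (𝓕 : Family r) : ℕ :=
  sSup {k : ℕ | ∃ G : RGraph r (Fin n), G.IsFree 𝓕 ∧ G.edges.card = k}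

/-- `α` is the Turán density of `𝓕`: the limit of `ex (n, 𝓕) / (n choose r)`. -/
def HasTuranDensity {r : ℕ} (𝓕 : Family r) (α : ℝ) : Prop :=
  Tendsto (fun n : ℕ => (ex n 𝓕 : ℝ) / (n.choose r : ℝ)) atTop (𝓝 α)

/-- The set of all Turán densities of families of `r`-graphs. -/
def turanDensities (r : ℕ) : Set ℝ :=
  {α | ∃ 𝓕 : Family r, HasTuranDensity 𝓕 α}

/-- `α ∈ (0, 1)` is a jump for `r`-graphs if, for some `ε > 0`, no Turán density of a family of
`r`-graphs lies in `(α, α + ε)`. -/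
def IsJump (r : ℕ) (α : ℝ) : Prop :=
  α ∈ Set.Ioo (0 : ℝ) 1 ∧ ∃ ε > 0, turanDensities r ∩ Set.Ioo α (α + ε) = ∅

/-- `α ∈ (0, 1)` is a non-jump for `r`-graphs if it is not a jump for `r`-graphs. -/
def IsNonJump (r : ℕ) (α : ℝ) : Prop :=
  α ∈ Set.Ioo (0 : ℝ) 1 ∧ ¬ IsJump r α

end RGraph

/-! By induction it suffices to pass from `q` to `q + 1`. Given a family `𝓕` of `r`-graphs, allow
exactly those `(r + 1)`-graphs whose edges are an edge of an `𝓕`-free graph on a set `A` plus one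
vertex outside `A`. On `n` vertices the maximum is that of `(n - a) * ex a 𝓕` over `a`, attained
asymptotically at `a = rn/(r + 1)`, so the density `d` of `𝓕` becomes `d * (r/(r + 1))^r`
(`HasTuranDensity.coneFamily`). This scaling carries densities just above `α` to densities just
above its image, hence non-jumps to non-jumps (`IsNonJump.succ`). -/

namespace RGraph

variable {r : ℕ} {V W : Type*}

/-- The pullback of an `r`-graph along an embedding of vertex sets. -/
noncomputable def comap (f : V ↪ W) (G : RGraph r W) : RGraph r V where
  edges := G.edges.preimage (Finset.map f) (Finset.map_injective f).injOn
  sized := fun e he => by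
    have := G.sized (Finset.mem_coe.2 (Finset.mem_preimage.1 (Finset.mem_coe.1 he)))
    rwa [Finset.card_map] at this

lemma mem_edges_comap {f : V ↪ W} {G : RGraph r W} {e : Finset V} :
    e ∈ (G.comap f).edges ↔ e.map f ∈ G.edges := by
  simp only [comap, Finset.mem_preimage]

lemma comap_isContained (f : V ↪ W) (G : RGraph r W) : (G.comap f).IsContained G :=
  ⟨f, fun _ he => mem_edges_comap.1 he⟩

lemma IsContained.refl (G : RGraph r V) : G.IsContained G :=
  ⟨Function.Embedding.refl V, fun e he => by simpa using he⟩

lemma IsContained.trans {U : Type*} {F : RGraph r U} {G : RGraph r V} {H : RGraph r W}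
    (h₁ : F.IsContained G) (h₂ : G.IsContained H) : F.IsContained H := by
  obtain ⟨f, hf⟩ := h₁
  obtain ⟨g, hg⟩ := h₂
  refine ⟨f.trans g, fun e he => ?_⟩
  rw [← Finset.map_map]
  exact hg _ (hf e he)

lemma IsFree.mono {𝓕 : Family r} {G : RGraph r V} {H : RGraph r W} (hH : H.IsFree 𝓕)
    (h : G.IsContained H) : G.IsFree 𝓕 :=
  fun F hF hFG => hH F hF (hFG.trans h)

lemma card_edges_comap_equiv (f : V ≃ W) (G : RGraph r W) :
    (G.comap f.toEmbedding).edges.card = G.edges.card := by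
  refine Finset.card_bij' (fun e _ => e.map f.toEmbedding) (fun e _ => e.map f.symm.toEmbedding)
    (fun e he => mem_edges_comap.1 he) (fun e he => ?_) (fun e _ => ?_) (fun e _ => ?_)
  · rw [mem_edges_comap, Finset.map_map]
    simpa using he
  · simp [Finset.map_map]
  · simp [Finset.map_map]

lemma bddAbove_card_edges (n : ℕ) (𝓕 : Family r) :
    BddAbove {k : ℕ | ∃ G : RGraph r (Fin n), G.IsFree 𝓕 ∧ G.edges.card = k} := by
  refine ⟨Fintype.card (Finset (Fin n)), ?_⟩
  rintro k ⟨G, -, rfl⟩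
  exact Finset.card_le_univ _

lemma card_edges_le_ex [Fintype V] {𝓕 : Family r} {G : RGraph r V} (hG : G.IsFree 𝓕) :
    G.edges.card ≤ ex (Fintype.card V) 𝓕 := by
  let f := (Fintype.equivFin V).symm
  rw [← card_edges_comap_equiv f]
  exact le_csSup (bddAbove_card_edges _ 𝓕) ⟨_, hG.mono (comap_isContained _ _), rfl⟩

lemma ex_le {n k : ℕ} {𝓕 : Family r}
    (h : ∀ G : RGraph r (Fin n), G.IsFree 𝓕 → G.edges.card ≤ k) : ex n 𝓕 ≤ k := by
  refine csSup_le' ?_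
  rintro _ ⟨G, hG, rfl⟩
  exact h G hG

lemma exists_free_card_edges_eq_ex {n : ℕ} {𝓕 : Family r} (h : ex n 𝓕 ≠ 0) :
    ∃ G : RGraph r (Fin n), G.IsFree 𝓕 ∧ G.edges.card = ex n 𝓕 := by
  refine Nat.sSup_mem ?_ (bddAbove_card_edges n 𝓕)
  by_contra hne
  rw [Set.not_nonempty_iff_eq_empty] at hne
  exact h (by simp [ex, hne])

/-! ### Cones over free graphs -/

/-- `H` is conic over `𝓕`-free graphs: for some vertex set `A` carrying an `𝓕`-free `r`-graph, each
edge of `H` is an edge of that graph together with one vertex outside `A`. -/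
def IsConic (𝓕 : Family r) (H : RGraph (r + 1) W) : Prop :=
  ∃ (A : Set W) (G : RGraph r A), G.IsFree 𝓕 ∧
    ∀ e ∈ H.edges, ∃ v ∉ A, ∃ f ∈ G.edges,
      (e : Set W) = insert v (f.map (Function.Embedding.subtype (· ∈ A)) : Set W)

lemma IsConic.mono {𝓕 : Family r} {H : RGraph (r + 1) V} {K : RGraph (r + 1) W}
    (hK : IsConic 𝓕 K) (h : H.IsContained K) : IsConic 𝓕 H := by
  obtain ⟨A, G, hG, hA⟩ := hK
  obtain ⟨g, hg⟩ := h
  let φ : (g ⁻¹' A) ↪ A :=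
    ⟨fun x => ⟨g x, x.2⟩, fun x y hxy => Subtype.ext (g.injective (congrArg Subtype.val hxy))⟩
  refine ⟨g ⁻¹' A, G.comap φ, hG.mono (comap_isContained _ _), fun e he => ?_⟩
  obtain ⟨w, hw, f, hf, hef⟩ := hA _ (hg e he)
  rw [Finset.coe_map] at hef
  have hmem : ∀ x, x ∈ (g '' e : Set W) ↔ x = w ∨ ∃ y ∈ f, (y : W) = x := by
    intro x
    rw [hef]
    simp
  obtain ⟨v, hv, rfl⟩ := (hmem w).2 (Or.inl rfl)
  have key : ∀ y ∈ f, ∃ x : (g ⁻¹' A), x.1 ∈ e ∧ φ x = y := by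
    intro y hy
    obtain ⟨x, hx, hxy⟩ := (hmem y).2 (Or.inr ⟨y, hy, rfl⟩)
    exact ⟨⟨x, by simp [hxy]⟩, hx, Subtype.ext hxy⟩
  have hfr : ((f.preimage φ φ.injective.injOn).map φ) = f := by
    ext y
    simp only [Finset.mem_map, Finset.mem_preimage]
    constructor
    · rintro ⟨x, hx, rfl⟩
      exact hx
    · intro hy
      obtain ⟨x, -, rfl⟩ := key y hy
      exact ⟨x, hy, rfl⟩
  refine ⟨v, hw, f.preimage φ φ.injective.injOn, ?_, ?_⟩
  · rw [mem_edges_comap, hfr]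
    exact hf
  · ext x
    have hx := hmem (g x)
    rw [g.injective.mem_set_image, Finset.mem_coe] at hx
    simp only [Finset.mem_coe, hx, Set.mem_insert_iff, Finset.mem_map, Finset.mem_preimage,
      g.injective.eq_iff]
    refine or_congr Iff.rfl ⟨?_, ?_⟩
    · rintro ⟨y, hy, hyx⟩
      refine ⟨⟨x, by simp [← hyx]⟩, ?_, rfl⟩
      convert hy
      exact Subtype.ext hyx.symm
    · rintro ⟨z, hz, rfl⟩
      exact ⟨φ z, hz, rfl⟩

/-- The family of all `(r + 1)`-graphs that are not conic over `𝓕`-free graphs. -/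
def coneFamily (𝓕 : Family r) : Family (r + 1) :=
  {H | ¬ IsConic 𝓕 H.2}

/-- A property inherited by subgraphs (`IsConic.mono`) is the same as freeness from all graphs
violating it. -/
lemma isFree_coneFamily_iff {𝓕 : Family r} {n : ℕ} {H : RGraph (r + 1) (Fin n)} :
    H.IsFree (coneFamily 𝓕) ↔ IsConic 𝓕 H := by
  refine ⟨fun h => ?_, fun h F hF hFH => hF (h.mono hFH)⟩
  by_contra hH
  exact h ⟨n, H⟩ hH (IsContained.refl H)

lemma IsConic.card_edges_le {𝓕 : Family r} {n : ℕ} {H : RGraph (r + 1) (Fin n)}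
    (hH : IsConic 𝓕 H) : ∃ a ≤ n, H.edges.card ≤ (n - a) * ex a 𝓕 := by
  classical
  obtain ⟨A, G, hG, hA⟩ := hH
  refine ⟨Fintype.card A, (Fintype.card_subtype_le _).trans_eq (Fintype.card_fin n), ?_⟩
  let j : ↥(Aᶜ) × Finset A → Finset (Fin n) :=
    fun p => insert p.1.1 (p.2.map (Function.Embedding.subtype (· ∈ A)))
  have hsub : H.edges ⊆ (Finset.univ ×ˢ G.edges).image j := by
    intro e he
    obtain ⟨v, hv, f, hf, hef⟩ := hA e he
    refine Finset.mem_image.2 ⟨(⟨v, hv⟩, f), by simp [hf], ?_⟩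
    rw [← Finset.coe_inj, hef, Finset.coe_insert]
  calc H.edges.card ≤ _ := Finset.card_le_card hsub
    _ ≤ _ := Finset.card_image_le
    _ = (n - Fintype.card A) * G.edges.card := by
      rw [Finset.card_product, Finset.card_univ, Fintype.card_compl_set, Fintype.card_fin]
    _ ≤ _ := Nat.mul_le_mul_left _ (card_edges_le_ex hG)

lemma mul_ex_le_ex_coneFamily (𝓕 : Family r) (a b : ℕ) :
    b * ex a 𝓕 ≤ ex (a + b) (coneFamily 𝓕) := by
  classical
  by_cases h0 : ex a 𝓕 = 0
  · simp [h0]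
  obtain ⟨G, hG, hcard⟩ := exists_free_card_edges_eq_ex h0
  let j : Fin b × Finset (Fin a) → Finset (Fin (a + b)) :=
    fun p => insert (Fin.natAdd a p.1) (p.2.map (Fin.castAddEmb b))
  have hnot : ∀ (v : Fin b) (f : Finset (Fin a)), Fin.natAdd a v ∉ f.map (Fin.castAddEmb b) := by
    intro v f hv
    obtain ⟨x, -, hx⟩ := Finset.mem_map.1 hv
    have := congrArg Fin.val hx
    simp at this
    omega
  have hjl : ∀ p (v : Fin b), Fin.natAdd a v ∈ j p ↔ v = p.1 := by
    intro p v
    rw [Finset.mem_insert, or_iff_left (hnot v p.2)]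
    exact (Fin.natAdd_injective b a).eq_iff
  have hjr : ∀ p (x : Fin a), Fin.castAdd b x ∈ j p ↔ x ∈ p.2 := by
    intro p x
    rw [Finset.mem_insert, or_iff_right]
    · exact Finset.mem_map' (Fin.castAddEmb b)
    · intro hx
      have := congrArg Fin.val hx
      simp at this
      omega
  have hj : Function.Injective j := by
    intro p q hpq
    refine Prod.ext ((hjl q p.1).1 ?_) (Finset.ext fun x => ?_)
    · rw [← hpq]
      exact (hjl p _).2 rfl
    · rw [← hjr p, ← hjr q, hpq]
  let H : RGraph (r + 1) (Fin (a + b)) :=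
    { edges := (Finset.univ ×ˢ G.edges).image j
      sized := by
        intro e he
        obtain ⟨⟨v, f⟩, hp, rfl⟩ := Finset.mem_image.1 (Finset.mem_coe.1 he)
        rw [Finset.card_insert_of_notMem (hnot v f), Finset.card_map]
        exact congrArg (· + 1) (G.sized (Finset.mem_product.1 hp).2) }
  have hHc : H.edges.card = b * ex a 𝓕 := by
    rw [← hcard]
    simp [H, Finset.card_image_of_injective _ hj, Finset.card_product]
  rw [← hHc]
  refine le_csSup (bddAbove_card_edges _ _) ⟨H, isFree_coneFamily_iff.2 ?_, rfl⟩
  let ψ : Fin a ≃ Set.range (Fin.castAddEmb b : Fin a → Fin (a + b)) :=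
    Equiv.ofInjective _ (Fin.castAddEmb b).injective
  refine ⟨_, G.comap ψ.symm.toEmbedding, hG.mono (comap_isContained _ _), fun e he => ?_⟩
  obtain ⟨⟨v, f⟩, hp, rfl⟩ := Finset.mem_image.1 he
  refine ⟨Fin.natAdd a v, ?_, f.map ψ.toEmbedding, ?_, ?_⟩
  · rintro ⟨x, hx⟩
    exact hnot v {x} (Finset.mem_map.2 ⟨x, by simp, hx⟩)
  · rw [mem_edges_comap, Finset.map_map, ← Equiv.trans_toEmbedding, Equiv.self_trans_symm]
    simpa using (Finset.mem_product.1 hp).2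
  · rw [Finset.coe_insert, Finset.map_map]
    congr 1

/-! ### Asymptotics of the Turán function -/

/-- Weighted AM-GM, with equality at `x = r * y`. It follows from Bernoulli's inequality for the
ratio `r(x + y) / ((r + 1)x)`, which is 1 in that case. -/
lemma mul_pow_le_pow (r : ℕ) {x y : ℝ} (hx : 0 ≤ x) (hy : 0 ≤ y) :
    ((r : ℝ) + 1) ^ (r + 1) * (y * x ^ r) ≤ (r : ℝ) ^ r * (x + y) ^ (r + 1) := by
  rcases Nat.eq_zero_or_pos r with rfl | hr
  · simpa using hx
  rcases hx.eq_or_lt with rfl | hx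
  · rw [zero_pow hr.ne']
    simp only [mul_zero]
    positivity
  have hr' : (0 : ℝ) < r := by exact_mod_cast hr
  have hpos : 0 ≤ r * (x + y) / ((r + 1) * x) := by positivity
  have bernoulli := one_add_mul_le_pow (a := r * (x + y) / ((r + 1) * x) - 1) (by linarith) (r + 1)
  rw [add_sub_cancel, div_pow, le_div_iff₀ (by positivity)] at bernoulli
  have hlhs : (1 + ((r + 1 : ℕ) : ℝ) * (r * (x + y) / ((r + 1) * x) - 1)) * ((r + 1) * x) ^ (r + 1)
      = r * ((r + 1) ^ (r + 1) * (y * x ^ r)) := by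
    rw [mul_pow, pow_succ x]
    push_cast
    field_simp
    ring
  rw [hlhs, mul_pow, pow_succ' (r : ℝ), mul_assoc] at bernoulli
  exact le_of_mul_le_mul_left bernoulli hr'

lemma tendsto_choose_div_pow (r : ℕ) :
    Tendsto (fun n : ℕ => (n.choose r : ℝ) / (n : ℝ) ^ r) atTop (𝓝 (1 / r.factorial)) := by
  have h := (Asymptotics.isEquivalent_iff_tendsto_one ?_).1 (isEquivalent_choose r)
  · refine (h.div_const (r.factorial : ℝ)).congr fun n => ?_
    rw [Pi.div_apply, div_div, div_mul_cancel₀ _ (by positivity)]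
  · filter_upwards [eventually_gt_atTop 0] with n hn
    positivity

lemma hasTuranDensity_iff {𝓕 : Family r} {d : ℝ} :
    HasTuranDensity 𝓕 d ↔
      Tendsto (fun n : ℕ => (ex n 𝓕 : ℝ) / (n : ℝ) ^ r) atTop (𝓝 (d / r.factorial)) := by
  have hf : (r.factorial : ℝ) ≠ 0 := by positivity
  constructor
  · intro h
    have := Tendsto.mul h (tendsto_choose_div_pow r)
    rw [mul_one_div] at this
    refine this.congr' ?_
    filter_upwards [eventually_ge_atTop r] with n hn
    have := Nat.choose_pos hn
    exact div_mul_div_cancel₀ (by positivity)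
  · intro h
    have := h.div (tendsto_choose_div_pow r) (by positivity)
    rw [div_div_div_cancel_right₀ hf, div_one] at this
    refine this.congr' ?_
    filter_upwards [eventually_gt_atTop 0] with n hn
    exact div_div_div_cancel_right₀ (by positivity) _ _

/-- The constant `K` absorbs the finitely many small `n`. A bound for every `n` is needed because
the base size `a` in the cone bound need not grow with `n`. -/
lemma le_mul_pow_add_of_tendsto {u : ℕ → ℝ} {k l : ℝ}
    (h : Tendsto (fun n : ℕ => u n / (n : ℝ) ^ r) atTop (𝓝 k)) (hkl : k < l) (hl : 0 ≤ l) :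
    ∃ K, ∀ n, u n ≤ l * (n : ℝ) ^ r + K := by
  obtain ⟨N, hN⟩ := eventually_atTop.1 ((h.eventually_lt_const hkl).and (eventually_gt_atTop 0))
  refine ⟨∑ i ∈ Finset.range N, |u i|, fun n => ?_⟩
  rcases lt_or_ge n N with hn | hn
  · calc u n ≤ |u n| := le_abs_self _
      _ ≤ ∑ i ∈ Finset.range N, |u i| :=
        Finset.single_le_sum (f := fun i => |u i|) (fun _ _ => abs_nonneg _) (Finset.mem_range.2 hn)
      _ ≤ _ := le_add_of_nonneg_left (by positivity)
  · obtain ⟨h₁, h₂⟩ := hN n hn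
    rw [div_lt_iff₀ (by positivity)] at h₁
    exact h₁.le.trans (le_add_of_nonneg_right (by positivity))

lemma tendsto_ex_coneFamily (hr : 1 ≤ r) {𝓕 : Family r} {k : ℝ}
    (h : Tendsto (fun n : ℕ => (ex n 𝓕 : ℝ) / (n : ℝ) ^ r) atTop (𝓝 k)) :
    Tendsto (fun n : ℕ => (ex n (coneFamily 𝓕) : ℝ) / (n : ℝ) ^ (r + 1)) atTop
      (𝓝 (k * ((r : ℝ) ^ r / ((r : ℝ) + 1) ^ (r + 1)))) := by
  have hk : 0 ≤ k := ge_of_tendsto' h fun n => by positivity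
  have hr' : (0 : ℝ) < r := by exact_mod_cast hr
  set c : ℝ := (r : ℝ) ^ r / ((r : ℝ) + 1) ^ (r + 1) with hc
  have hcpos : 0 < c := by positivity
  refine tendsto_order.2 ⟨fun l hl => ?_, fun m hm => ?_⟩
  -- Lower bound: use `⌊n/(r + 1)⌋` apexes and let the remaining vertices carry an extremal `𝓕`-free
  -- graph.
  · have hb : Tendsto (fun n : ℕ => ((n / (r + 1) : ℕ) : ℝ) / n) atTop (𝓝 (1 / ((r : ℝ) + 1))) := by
      have := (tendsto_nat_floor_mul_div_atTop (R := ℝ) (a := 1 / ((r : ℝ) + 1))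
        (by positivity)).comp tendsto_natCast_atTop_atTop
      refine this.congr fun n => ?_
      simp only [Function.comp_apply]
      rw [one_div_mul_eq_div, ← Nat.floor_div_eq_div (K := ℝ)]
      push_cast
      rfl
    have ha : Tendsto (fun n : ℕ => ((n - n / (r + 1) : ℕ) : ℝ) / n) atTop
        (𝓝 ((r : ℝ) / ((r : ℝ) + 1))) := by
      have := hb.const_sub 1
      rw [one_sub_div (by positivity), add_sub_cancel_right] at this
      refine this.congr' ?_
      filter_upwards [eventually_gt_atTop 0] with n hn
      rw [Nat.cast_sub (Nat.div_le_self _ _), sub_div, div_self (by positivity)]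
    have hle : ∀ n : ℕ, n / 2 ≤ n - n / (r + 1) := by
      intro n
      have := Nat.div_le_div_left (a := n) (show 2 ≤ r + 1 by omega) two_pos
      omega
    have ha' : Tendsto (fun n : ℕ => n - n / (r + 1)) atTop atTop :=
      tendsto_atTop_mono hle (Nat.tendsto_div_const_atTop two_ne_zero)
    have hlim := ((h.comp ha').mul (ha.pow r)).mul hb
    have hval : k * ((r : ℝ) / (r + 1)) ^ r * (1 / (r + 1)) = k * c := by
      rw [hc, div_pow, pow_succ]
      field_simp
    rw [hval] at hlim
    filter_upwards [hlim.eventually_const_lt hl, eventually_gt_atTop 1] with n hn hn1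
    refine hn.trans_le ?_
    have hn0 : 0 < n := by omega
    have han : 0 < n - n / (r + 1) := (Nat.div_pos hn1 two_pos).trans_le (hle n)
    have hex := mul_ex_le_ex_coneFamily 𝓕 (n - n / (r + 1)) (n / (r + 1))
    rw [Nat.sub_add_cancel (Nat.div_le_self _ _)] at hex
    have hex' : ((n / (r + 1) : ℕ) : ℝ) * ex (n - n / (r + 1)) 𝓕 ≤ ex n (coneFamily 𝓕) := by
      exact_mod_cast hex
    simp only [Function.comp_apply]
    rw [div_pow, div_mul_div_cancel₀ (by positivity), div_mul_div_comm, ← pow_succ, mul_comm]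
    gcongr
  -- Upper bound: AM-GM controls the main term for every `a`, and the error `K * n` is negligible
  -- against `n^(r + 1)` since `r ≥ 1`.
  · obtain ⟨l, hkl, hlm⟩ := exists_between ((lt_div_iff₀ hcpos).2 hm)
    rw [lt_div_iff₀ hcpos] at hlm
    obtain ⟨K, hK⟩ := le_mul_pow_add_of_tendsto h hkl (hk.trans hkl.le)
    have hK0 : 0 ≤ K := by
      have := hK 0
      rw [Nat.cast_zero, zero_pow (by omega), mul_zero, zero_add] at this
      exact (Nat.cast_nonneg _).trans this
    have hlim : Tendsto (fun n : ℕ => l * c + K * ((n : ℝ) ^ r)⁻¹) atTop (𝓝 (l * c + K * 0)) :=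
      ((tendsto_inv_atTop_zero.comp ((tendsto_pow_atTop (by omega)).comp
        tendsto_natCast_atTop_atTop)).const_mul K).const_add _
    rw [mul_zero, add_zero] at hlim
    filter_upwards [hlim.eventually_lt_const hlm, eventually_gt_atTop 0] with n hn hn0
    refine lt_of_le_of_lt ?_ hn
    have hnR : (0 : ℝ) < n := by exact_mod_cast hn0
    rw [div_le_iff₀ (by positivity)]
    refine le_trans ?_ (b := l * c * (n : ℝ) ^ (r + 1) + K * n) (le_of_eq ?_)
    · have hnat : ∃ a ≤ n, ex n (coneFamily 𝓕) ≤ (n - a) * ex a 𝓕 := by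
        by_cases h0 : ex n (coneFamily 𝓕) = 0
        · exact ⟨0, Nat.zero_le _, by simp [h0]⟩
        · obtain ⟨H, hH, hcard⟩ := exists_free_card_edges_eq_ex h0
          rw [← hcard]
          exact (isFree_coneFamily_iff.1 hH).card_edges_le
      obtain ⟨a, han, hle⟩ := hnat
      have hanR : (a : ℝ) ≤ n := by exact_mod_cast han
      have hamgm := mul_pow_le_pow r (Nat.cast_nonneg (α := ℝ) a) (sub_nonneg.2 hanR)
      rw [add_sub_cancel, ← le_div_iff₀' (by positivity), mul_div_right_comm, ← hc] at hamgm
      calc (ex n (coneFamily 𝓕) : ℝ) ≤ ((n - a : ℕ) : ℝ) * ex a 𝓕 := by exact_mod_cast hle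
        _ = ((n : ℝ) - a) * ex a 𝓕 := by rw [Nat.cast_sub han]
        _ ≤ ((n : ℝ) - a) * (l * (a : ℝ) ^ r + K) :=
          mul_le_mul_of_nonneg_left (hK a) (sub_nonneg.2 hanR)
        _ = l * (((n : ℝ) - a) * (a : ℝ) ^ r) + K * (n - a) := by ring
        _ ≤ l * (c * (n : ℝ) ^ (r + 1)) + K * n :=
          add_le_add (mul_le_mul_of_nonneg_left hamgm (hk.trans hkl.le))
            (mul_le_mul_of_nonneg_left (sub_le_self _ (Nat.cast_nonneg a)) hK0)
        _ = _ := by rw [mul_assoc]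
    · rw [pow_succ]
      field_simp

lemma HasTuranDensity.coneFamily (hr : 1 ≤ r) {𝓕 : Family r} {d : ℝ} (h : HasTuranDensity 𝓕 d) :
    HasTuranDensity (coneFamily 𝓕) (d * ((r : ℝ) / ((r : ℝ) + 1)) ^ r) := by
  rw [hasTuranDensity_iff]
  convert tendsto_ex_coneFamily hr (hasTuranDensity_iff.1 h) using 2
  rw [Nat.factorial_succ, div_pow, pow_succ]
  push_cast
  have : (r.factorial : ℝ) ≠ 0 := by positivity
  field_simp

/-! ### Non-jumps -/

lemma isNonJump_iff {α : ℝ} : IsNonJump r α ↔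
    α ∈ Set.Ioo (0 : ℝ) 1 ∧ ∀ ε > 0, ∃ d ∈ turanDensities r, α < d ∧ d < α + ε := by
  refine and_congr_right fun hα => ?_
  simp only [IsJump, hα, true_and, not_exists, not_and, ← ne_eq, ← Set.nonempty_iff_ne_empty]
  rfl

lemma IsNonJump.succ (hr : 1 ≤ r) {α : ℝ} (h : IsNonJump r α) :
    IsNonJump (r + 1) (α * ((r : ℝ) / ((r : ℝ) + 1)) ^ r) := by
  obtain ⟨⟨h0, h1⟩, hd⟩ := isNonJump_iff.1 h
  have hr' : (0 : ℝ) < r := by exact_mod_cast hr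
  set t : ℝ := ((r : ℝ) / ((r : ℝ) + 1)) ^ r with ht
  have htpos : 0 < t := by positivity
  have ht1 : t ≤ 1 :=
    pow_le_one₀ (by positivity) ((div_le_one (by positivity)).2 (le_add_of_nonneg_right zero_le_one))
  refine isNonJump_iff.2 ⟨⟨mul_pos h0 htpos, ?_⟩, fun ε hε => ?_⟩
  · exact (mul_le_of_le_one_right h0.le ht1).trans_lt h1
  · obtain ⟨d, ⟨𝓕, h𝓕⟩, hαd, hdε⟩ := hd ε hε
    refine ⟨d * t, ⟨_, h𝓕.coneFamily hr⟩, mul_lt_mul_of_pos_right hαd htpos, ?_⟩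
    calc d * t < (α + ε) * t := mul_lt_mul_of_pos_right hdε htpos
      _ = α * t + ε * t := add_mul _ _ _
      _ ≤ α * t + ε := add_le_add_right (mul_le_of_le_one_right hε.le ht1) _

end RGraph

theorem mainTheorem5 (r : ℕ) (hr : 3 ≤ r) (c : ℝ) (hc : 0 < c)
    (h : RGraph.IsNonJump r (c * ((r.factorial : ℝ) / (r : ℝ) ^ r))) :
    ∀ q : ℕ, r ≤ q → RGraph.IsNonJump q (c * ((q.factorial : ℝ) / (q : ℝ) ^ q)) := by
  intro q hq
  induction q, hq using Nat.le_induction with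
  | base => exact h
  | succ q hq ih =>
    convert ih.succ (by omega) using 1
    have hq' : (0 : ℝ) < q := by exact_mod_cast (by omega : 0 < q)
    -- The factor `(q/(q + 1))^q` turns `q!/q^q` into `q!/(q + 1)^q = (q + 1)!/(q + 1)^(q + 1)`.
    rw [Nat.factorial_succ, div_pow, pow_succ]
    push_cast
    field_simp
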